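/- Let $z=z(x,y)$ and consider the constant astigmatism equation $z_{yy}+(1/z)_{xx}+2=0$. Put $$K_1=-\tfrac{z_y}{4},\quad L_1=-\tfrac{z_x}{4z^2}+\tfrac x2,\quad K_2=-\tfrac{x z_y}{2},\quad L_2=-\tfrac{x z_x}{2z^2}-\tfrac1{2z}+\tfrac{x^2}{2},$$ $$\bar K_1=\tfrac{z_x}{4z^2},\quad \bar L_1=\tfrac{z_y}{4}+\tfrac y2,\quad \bar K_2=\tfrac{y z_x}{2z^2},\quad \bar L_2=\tfrac{y z_y}{2}-\tfrac z2+\tfrac{y^2}{2}.$$ Let $u_0=1$, $v_0=w_0=0$, let $u_n,v_n,w_n$ ($n\ge1$) be further variables, and define $\bar u_n$ by $\bar u_0=1$ and $$\bar u_{k+1}=\tfrac{1+xy}{2}\sum_{i=0}^k u_i\bar u_{k-i}-\tfrac y2\sum_{i=0}^k\bar u_i v_{k-i}+\tfrac12\sum_{i=0}^k(v_i-xu_i)w_{k-i}-\sum_{i=1}^{k+1}u_i\bar u_{k-i+1}.$$ For $n\ge1$ put $$\begin{aligned} u_{n,x}&=K_1u_{n-1}+\tfrac12(K_1+zL_1)\sum_{i=0}^{n-2}u_i-\tfrac14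 z\sum_{i=0}^{n-2}v_i,\\ u_{n,y}&=L_1u_{n-1}-\tfrac12v_{n-1}+\tfrac12\bigl(L_1+\tfrac{K_1}{z}\bigr)\sum_{i=0}^{n-2}u_i-\tfrac14\sum_{i=0}^{n-2}v_i,\\ v_{n,x}&=K_2u_{n-1}-K_1v_{n-1}+\tfrac12(K_2+zL_2)\sum_{i=0}^{n-2}u_i-\tfrac12(K_1+zL_1)\sum_{i=0}^{n-2}v_i,\\ v_{n,y}&=L_2u_{n-1}-L_1v_{n-1}+\tfrac12\bigl(L_2+\tfrac{K_2}{z}\bigr)\sum_{i=0}^{n-2}u_i-\tfrac12\bigl(L_1+\tfrac{K_1}{z}\bigr)\sum_{i=0}^{n-2}v_i,\\ w_{n,x}&=\bar L_2\bar u_{n-1}-\bar L_1w_{n-1}+\tfrac12(\bar L_2+z\bar K_2)\sum_{i=0}^{n-2}\bar u_i-\tfrac12(\bar L_1+z\bar K_1)\sum_{i=0}^{n-2}w_i,\\ w_{n,y}&=\bar K_2\bar u_{n-1}-\bar K_1w_{n-1}+\tfrac12\bigl(\bar K_2+\tfrac{\bar L_2}{z}\bigr)\sum_{i=0}^{n-2}\bar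 u_i-\tfrac12\bigl(\bar K_1+\tfrac{\bar L_1}{z}\bigr)\sum_{i=0}^{n-2}w_i. \end{aligned}$$ Let $\tilde{\mathcal E}$ be the space with coordinates $x$, $y$, the jet coordinates $z_\mu$ with $\mu$ running over the monomials $x^k$ and $x^ky$ (where $z_1=z>0$), and $u_n,v_n,w_n$ ($n\ge1$). On functions of finitely many of these coordinates define the total derivatives $$\tilde D_x=\frac{\partial}{\partial x}+\sum_\mu z_{\mu x}\frac{\partial}{\partial z_\mu}+\sum_{n\ge1}\Bigl(u_{n,x}\frac{\partial}{\partial u_n}+v_{n,x}\frac{\partial}{\partial v_n}+w_{n,x}\frac{\partial}{\partial w_n}\Bigr),$$ $$\tilde D_y=\frac{\partial}{\partial y}+\sum_\mu z_{\mu y}\frac{\partial}{\partial z_\mu}+\sum_{n\ge1}\Bigl(u_{n,y}\frac{\partial}{\partial u_n}+v_{n,y}\frac{\partial}{\partial v_n}+w_{n,y}\frac{\partial}{\partial w_n}\Bigr),$$ where $z_{yy}=-\tilde D_x^2(1/z)-2$ and $z_{x^kyy}=-\tilde D_x^{k+2}(1/z)$ for $k>0$. There is no functional dependence among the potentials $u_i,v_i,w_i$.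 Precisely, let $N\ge0$, let $U\subseteq\mathbb R^{3N}$ be open, and let $F=F(u_1,\dots,u_N,v_1,\dots,v_N,w_1,\dots,w_N)$ be a smooth real function on $U$. (a) $F=0$ is not a nondegenerate relation compatible with the covering: it is impossible that $F$ has a zero in $U$, that $dF\neq0$ at every zero of $F$ in $U$, and that $\tilde D_xF=\tilde D_yF=0$ at every point of $\tilde{\mathcal E}$ whose coordinates $(u_1,\dots,w_N)$ lie in $U$ and satisfy $F=0$. (b) If $U$ is connected and non-empty and $\tilde D_xF=\tilde D_yF=0$ at every point of $\tilde{\mathcal E}$ whose coordinates $(u_1,\dots,w_N)$ lie in $U$, then $F$ is constant on $U$. -/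

import Mathlib

open scoped ContDiff

namespace ConstantAstigmatism

/-- Coordinates on the covering of the constant astigmatism equation
`z_yy + (1/z)_xx + 2 = 0` by the potentials `u_n, v_n, w_n`, `n ≥ 1`.
The equation and its differential consequences express every jet coordinate divisible by `yy`
through the coordinates `z k = z_{x…x}` and `zy k = z_{x…xy}` (`k` letters `x`).
The coordinates `u n, v n, w n` stand for the potentials `u_{n+1}, v_{n+1}, w_{n+1}`. -/
inductive Coord : Type
  | x : Coord
  | y : Coord
  | z (k : ℕ) : Coord
  | zy (k : ℕ) : Coord
  | u (n : ℕ) : Coord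
  | v (n : ℕ) : Coord
  | w (n : ℕ) : Coord
  deriving DecidableEq

/-- Values of all coordinates. -/
abbrev Point : Type := Coord → ℝ

/-- The covering manifold: the points with `z > 0`. -/
def covering : Set Point := {p | 0 < p (.z 0)}

noncomputable section

/-! ### The potentials and the coefficients of the covering -/

/-- `u_n`, with `u_0 = 1`. -/
def uPot (p : Point) : ℕ → ℝ
  | 0 => 1
  | n + 1 => p (.u n)

/-- `v_n`, with `v_0 = 0`. -/
def vPot (p : Point) : ℕ → ℝ
  | 0 => 0
  | n + 1 => p (.v n)

/-- `w_n`, with `w_0 = 0`. -/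
def wPot (p : Point) : ℕ → ℝ
  | 0 => 0
  | n + 1 => p (.w n)

def K₁ (p : Point) : ℝ := -(p (.zy 0)) / 4

def L₁ (p : Point) : ℝ := -(p (.z 1)) / (4 * p (.z 0) ^ 2) + p .x / 2

def K₂ (p : Point) : ℝ := -(p .x * p (.zy 0)) / 2

def L₂ (p : Point) : ℝ :=
  -(p .x * p (.z 1)) / (2 * p (.z 0) ^ 2) - 1 / (2 * p (.z 0)) + p .x ^ 2 / 2

/-- The dual coefficient `K̄₁`. -/
def dK₁ (p : Point) : ℝ := p (.z 1) / (4 * p (.z 0) ^ 2)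

/-- The dual coefficient `L̄₁`. -/
def dL₁ (p : Point) : ℝ := p (.zy 0) / 4 + p .y / 2

/-- The dual coefficient `K̄₂`. -/
def dK₂ (p : Point) : ℝ := p .y * p (.z 1) / (2 * p (.z 0) ^ 2)

/-- The dual coefficient `L̄₂`. -/
def dL₂ (p : Point) : ℝ := p .y * p (.zy 0) / 2 - p (.z 0) / 2 + p .y ^ 2 / 2

/-- The functions `ū_n` of `x, y` and of the potentials, determined by `ū_0 = 1` and
`ū_{k+1} = (1 + x y)/2 ∑_{i=0}^k u_i ū_{k-i} - y/2 ∑_{i=0}^k ū_i v_{k-i}`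
`  + 1/2 ∑_{i=0}^k (v_i - x u_i) w_{k-i} - ∑_{i=1}^{k+1} u_i ū_{k+1-i}`.
In the code the last sum runs over `i - 1`. -/
def uBar (p : Point) : ℕ → ℝ
  | 0 => 1
  | k + 1 =>
      (1 + p .x * p .y) / 2 * ∑ i : Fin (k + 1), uPot p i * uBar p (k - i)
        - p .y / 2 * ∑ i : Fin (k + 1), uBar p i * vPot p (k - i)
        + 1 / 2 * ∑ i : Fin (k + 1), (vPot p i - p .x * uPot p i) * wPot p (k - i)
        - ∑ i : Fin (k + 1), uPot p (i + 1) * uBar p (k - i)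
  termination_by n => n

/-- `psum f n = ∑_{i=0}^{n-1} f i`. -/
def psum (f : ℕ → ℝ) (n : ℕ) : ℝ := ∑ i ∈ Finset.range n, f i

/-! In the following six formulas the argument `m` stands for `n = m + 1 ≥ 1`, so that
`n - 1 = m` and `∑_{i=0}^{n-2} f i = psum f m`. -/

/-- `u_{n,x}` -/
def uX (p : Point) (m : ℕ) : ℝ :=
  K₁ p * uPot p m + 1 / 2 * (K₁ p + p (.z 0) * L₁ p) * psum (uPot p) m
    - 1 / 4 * p (.z 0) * psum (vPot p) m

/-- `u_{n,y}` -/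
def uY (p : Point) (m : ℕ) : ℝ :=
  L₁ p * uPot p m - 1 / 2 * vPot p m + 1 / 2 * (L₁ p + K₁ p / p (.z 0)) * psum (uPot p) m
    - 1 / 4 * psum (vPot p) m

/-- `v_{n,x}` -/
def vX (p : Point) (m : ℕ) : ℝ :=
  K₂ p * uPot p m - K₁ p * vPot p m + 1 / 2 * (K₂ p + p (.z 0) * L₂ p) * psum (uPot p) m
    - 1 / 2 * (K₁ p + p (.z 0) * L₁ p) * psum (vPot p) m

/-- `v_{n,y}` -/
def vY (p : Point) (m : ℕ) : ℝ :=
  L₂ p * uPot p m - L₁ p * vPot p m + 1 / 2 * (L₂ p + K₂ p / p (.z 0)) * psum (uPot p) m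
    - 1 / 2 * (L₁ p + K₁ p / p (.z 0)) * psum (vPot p) m

/-- `w_{n,x}` -/
def wX (p : Point) (m : ℕ) : ℝ :=
  dL₂ p * uBar p m - dL₁ p * wPot p m + 1 / 2 * (dL₂ p + p (.z 0) * dK₂ p) * psum (uBar p) m
    - 1 / 2 * (dL₁ p + p (.z 0) * dK₁ p) * psum (wPot p) m

/-- `w_{n,y}` -/
def wY (p : Point) (m : ℕ) : ℝ :=
  dK₂ p * uBar p m - dK₁ p * wPot p m + 1 / 2 * (dK₂ p + dL₂ p / p (.z 0)) * psum (uBar p) m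
    - 1 / 2 * (dK₁ p + dL₁ p / p (.z 0)) * psum (wPot p) m

/-! ### Total derivatives on the covering -/

/-- The partial derivative of `G` with respect to the coordinate `c`. -/
def pd (c : Coord) (G : Point → ℝ) (p : Point) : ℝ :=
  deriv (fun t : ℝ => G (Function.update p c t)) (p c)

/-- The component along `∂/∂c` of the total derivative in the direction `x`. -/
def xRate (p : Point) : Coord → ℝ
  | .x => 1
  | .y => 0
  | .z k => p (.z (k + 1))
  | .zy k => p (.zy (k + 1))
  | .u m => uX p m
  | .v m => vX p m
  | .w m => wX p m

/-- The total derivative `D_x` on the covering, for functions of finitely many coordinates. -/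
def totalDx (G : Point → ℝ) (p : Point) : ℝ := ∑ᶠ c : Coord, xRate p c * pd c G p

/-- The jet coordinate `z_{x…xyy}` (`k` letters `x`), as the equation prescribes it:
`-(D_x)^{k+2} (1/z)` for `k > 0`, and `-(1/z)_{xx} - 2` for `k = 0`. -/
def zyy (p : Point) (k : ℕ) : ℝ :=
  -(totalDx^[k + 2] (fun q => 1 / q (.z 0)) p) - if k = 0 then 2 else 0

/-- The component along `∂/∂c` of the total derivative in the direction `y`. -/
def yRate (p : Point) : Coord → ℝ
  | .x => 0
  | .y => 1
  | .z k => p (.zy k)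
  | .zy k => zyy p k
  | .u m => uY p m
  | .v m => vY p m
  | .w m => wY p m

/-- The total derivative `D_y` on the covering, for functions of finitely many coordinates. -/
def totalDy (G : Point → ℝ) (p : Point) : ℝ := ∑ᶠ c : Coord, yRate p c * pd c G p

/-! ### Functional dependence of the potentials -/

/-- The space `ℝ^{3N}` of values of `(u_1, …, u_N), (v_1, …, v_N), (w_1, …, w_N)`. -/
abbrev PotSpace (N : ℕ) : Type := (Fin N → ℝ) × (Fin N → ℝ) × (Fin N → ℝ)

/-- The values at a point of the covering of the first `N` potentials of each kind. -/
def potentials (N : ℕ) (p : Point) : PotSpace N :=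
  (fun i => p (.u i), fun i => p (.v i), fun i => p (.w i))

/-- The relation `F(u_1, …, w_N) = 0`, for `F` defined on `U`, is compatible with the covering:
both total derivatives of its left-hand side vanish wherever the relation holds. -/
def IsCompatibleRelation {N : ℕ} (U : Set (PotSpace N)) (F : PotSpace N → ℝ) : Prop :=
  ∀ p ∈ covering, potentials N p ∈ U → F (potentials N p) = 0 →
    totalDx (fun q => F (potentials N q)) p = 0 ∧ totalDy (fun q => F (potentials N q)) p = 0

/-- `F(u_1, …, w_N) = 0` is a functional dependence among the potentials: `F` is a smooth function
on an open set, its zero set there is non-empty with `dF ≠ 0` along it, and the relation is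
compatible with the covering. -/
structure IsFunctionalDependence {N : ℕ} (U : Set (PotSpace N)) (F : PotSpace N → ℝ) : Prop where
  isOpen : IsOpen U
  smooth : ContDiffOn ℝ ∞ F U
  nonempty : ∃ a ∈ U, F a = 0
  regular : ∀ a ∈ U, F a = 0 → fderiv ℝ F a ≠ 0
  compatible : IsCompatibleRelation U F

/-- `F(u_1, …, w_N)`, for `F` defined on `U`, is killed by both total derivatives. -/
def IsKilledByTotalDerivatives {N : ℕ} (U : Set (PotSpace N)) (F : PotSpace N → ℝ) : Prop :=
  ∀ p ∈ covering, potentials N p ∈ U →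
    totalDx (fun q => F (potentials N q)) p = 0 ∧ totalDy (fun q => F (potentials N q)) p = 0

end

end ConstantAstigmatism

/-!
Let `F = 0` be a functional dependence. The fibre coordinates `z`, `z_x`, `z_y` vary freely over
each point of the space of potentials, so each coefficient of `D_x` and `D_y`, as functions of `z`,
`z_x`, `z_y`, is a vector field on that space tangent to the hypersurface `F = 0`. It suffices to
take `x = y = 0`.

Collect the potentials into series `u = ∑ u_n λ^n`, `v`, `w`, `ū`. The recurrence for `ū_n` then
says that `q = (2 - λ) ū` satisfies `q u - λ v w = 2`, so the matrix with rows `(u, v)` and `(λ w,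
q)` has constant determinant, and the fields found in `potentials_xRate` and `potentials_yRate_sub`
are infinitesimal right multiplications of this matrix by elements of the loop algebra of `sl₂`, up
to truncation at `λ^N`. Fields tangent to a regular hypersurface are closed under the Lie bracket
(`fderiv_lie_eq_zero`), and the brackets of these fields contain `λ^n` times each of the three
standard generators, for all `n ≥ 1` (`tangent_monomials`); the lower triangular one here carries
an additional factor `λ`, which the entry `λ w` absorbs. With respect to the order of the
potentials by index these fields are triangular with nonzero diagonal, so they span the tangent
space at every point. Hence `dF = 0` on the hypersurface, a contradiction.

If `D_x F = D_y F = 0` everywhere, the same applied to `F - F a` near a point `a` with `dF ≠ 0`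
shows that there is no such point.
-/

namespace ConstantAstigmatism

/-! ### Tangent fields and total derivatives -/

/-- Vector fields tangent to the regular level set `F = 0` have a tangent Lie bracket. As `dF(W)`
vanishes on the level set, the Lagrange multiplier rule makes its differential there a multiple of
`dF`, which kills `V`; the second derivatives of `F` cancel when `V` and `W` are exchanged. -/
theorem fderiv_lie_eq_zero {E : Type*} [NormedAddCommGroup E] [NormedSpace ℝ E] [CompleteSpace E]
    {U : Set E} (hU : IsOpen U) {F : E → ℝ} (hF : ContDiffOn ℝ ∞ F U)
    (hreg : ∀ a ∈ U, F a = 0 → fderiv ℝ F a ≠ 0) {V W : E → E}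
    (hV : ContDiff ℝ ∞ V) (hW : ContDiff ℝ ∞ W)
    (hVt : ∀ a ∈ U, F a = 0 → fderiv ℝ F a (V a) = 0)
    (hWt : ∀ a ∈ U, F a = 0 → fderiv ℝ F a (W a) = 0) {a : E} (ha : a ∈ U) (h0 : F a = 0) :
    fderiv ℝ F a (fderiv ℝ W a (V a) - fderiv ℝ V a (W a)) = 0 := by
  have hFa : ContDiffAt ℝ ∞ F a := hF.contDiffAt (hU.mem_nhds ha)
  have hdF : ContDiffAt ℝ ∞ (fderiv ℝ F) a := hFa.fderiv_right (by simp)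
  have hdd := (hdF.differentiableAt (by simp)).hasFDerivAt
  have key : ∀ V W : E → E, ContDiff ℝ ∞ W →
      (∀ a ∈ U, F a = 0 → fderiv ℝ F a (V a) = 0) →
      (∀ a ∈ U, F a = 0 → fderiv ℝ F a (W a) = 0) →
      fderiv ℝ (fderiv ℝ F) a (V a) (W a) + fderiv ℝ F a (fderiv ℝ W a (V a)) = 0 := by
    intro V W hW hVt hWt
    have hφ : ContDiffAt ℝ ∞ (fun b => fderiv ℝ F b (W b)) a := hdF.clm_apply hW.contDiffAt
    have hext : IsLocalExtrOn (fun b => fderiv ℝ F b (W b)) {x | F x = F a} a := by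
      left
      have hmem : ∀ᶠ x in nhdsWithin a {x | F x = F a}, x ∈ U :=
        nhdsWithin_le_nhds (hU.mem_nhds ha)
      filter_upwards [hmem, self_mem_nhdsWithin] with x hx hx'
      rw [hWt a ha h0, hWt x hx (hx'.trans h0)]
    obtain ⟨r, s, hrs, h⟩ := hext.exists_multipliers_of_hasStrictFDerivAt_1d
      (hFa.hasStrictFDerivAt (by simp)) (hφ.hasStrictFDerivAt (by simp))
    -- The multiplier of `dF(W)` is nonzero because `dF ≠ 0`.
    have hs : s ≠ 0 := by
      rintro rfl
      simp only [zero_smul, add_zero, smul_eq_zero] at h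
      rcases h with rfl | h
      · exact hrs rfl
      · exact hreg a ha h0 h
    have h' := DFunLike.congr_fun h (V a)
    have hd := hdd.clm_apply (hW.differentiable (by simp) a).hasFDerivAt
    rw [hd.fderiv] at h'
    simp only [_root_.add_apply, _root_.smul_apply, hVt a ha h0,
      ContinuousLinearMap.comp_apply, ContinuousLinearMap.flip_apply, smul_eq_mul, mul_zero,
      zero_add, _root_.zero_apply, mul_eq_zero, hs, false_or] at h'
    linarith
  have hsymm := (hFa.isSymmSndFDerivAt (by simpa using ENat.LEInfty.out)).eq (V a) (W a)
  have h1 := key V W hW hVt hWt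
  have h2 := key W V hV hWt hVt
  rw [map_sub]
  linarith

/-- Applied to a function of the first `N` potentials, a total derivative with components `r` is the
derivative of that function along the vector of rates of these potentials. -/
theorem totalD_eq_fderiv {N : ℕ} {F : PotSpace N → ℝ} {p : Point}
    (hF : DifferentiableAt ℝ F (potentials N p)) (r : Coord → ℝ) :
    ∑ᶠ c : Coord, r c * pd c (fun q => F (potentials N q)) p
      = fderiv ℝ F (potentials N p) (potentials N r) := by
  have hpd : ∀ c, pd c (fun q => F (potentials N q)) p
      = fderiv ℝ F (potentials N p) (potentials N (Pi.single c 1)) := by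
    intro c
    have hline : ∀ t, potentials N (Function.update p c t)
        = potentials N p + (t - p c) • potentials N (Pi.single c 1) := by
      intro t
      have : Function.update p c t = p + (t - p c) • (Pi.single c 1 : Point) := by
        ext d
        by_cases hd : d = c
        · subst hd; simp
        · simp [hd]
      rw [this]
      rfl
    unfold pd
    simp only [hline]
    have hl : HasDerivAt (fun t : ℝ => potentials N p + (t - p c) • potentials N (Pi.single c 1))
        (potentials N (Pi.single c 1)) (p c) := by
      simpa using (((hasDerivAt_id (p c)).sub_const (p c)).smul_const
        (potentials N (Pi.single c 1))).const_add (potentials N p)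
    have hF' : HasFDerivAt F (fderiv ℝ F (potentials N p))
        (potentials N p + (p c - p c) • potentials N (Pi.single c 1)) := by
      simpa using hF.hasFDerivAt
    exact (hF'.comp_hasDerivAt (p c) hl).deriv
  simp only [hpd]
  set s : Finset Coord := Finset.univ.image (fun i : Fin N => Coord.u i) ∪
    (Finset.univ.image (fun i : Fin N => Coord.v i) ∪
      Finset.univ.image (fun i : Fin N => Coord.w i)) with hs
  rw [finsum_eq_sum_of_support_subset (s := s)]
  · have hsum : potentials N r = ∑ c ∈ s, r c • potentials N (Pi.single c 1) := by
      refine Prod.ext ?_ (Prod.ext ?_ ?_) <;> ext i <;>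
        simp [potentials, Prod.fst_sum, Prod.snd_sum, Finset.sum_apply, Pi.single_apply, hs]
    rw [hsum, map_sum]
    simp
  · intro c hc
    by_contra hcs
    apply hc
    have : potentials N (Pi.single c 1) = 0 := by
      refine Prod.ext ?_ (Prod.ext ?_ ?_) <;> ext i <;>
        simp only [potentials, Prod.fst_zero, Prod.snd_zero, Pi.zero_apply] <;>
        refine Pi.single_eq_of_ne ?_ _ <;> rintro rfl <;> exact hcs (by simp [hs])
    simp [this]

open PowerSeries

noncomputable section

variable {N : ℕ}

/-! ### Generating series of the potentials -/

/-- Polynomials in `u_1, …, u_N, v_1, …, v_N, w_1, …, w_N`, in this order of the summands. -/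
abbrev PotPoly (N : ℕ) : Type := MvPolynomial (Fin N ⊕ Fin N ⊕ Fin N) ℝ

/-- Polynomial vector fields on the space of potentials, written as generating series in `λ = X`:
the coefficients of `λ^n`, `1 ≤ n ≤ N`, in the three series are the components along `∂/∂u_n`,
`∂/∂v_n`, `∂/∂w_n`. The other coefficients carry no information. -/
abbrev PolyField (N : ℕ) : Type := (PotPoly N)⟦X⟧ × (PotPoly N)⟦X⟧ × (PotPoly N)⟦X⟧

/-- The values of the variables of `PotPoly N` at a point of the space of potentials. -/
def coords (a : PotSpace N) : Fin N ⊕ Fin N ⊕ Fin N → ℝ :=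
  Sum.elim a.1 (Sum.elim a.2.1 a.2.2)

/-- Coefficientwise evaluation of a series at a point of the space of potentials. -/
def ev (a : PotSpace N) : (PotPoly N)⟦X⟧ →+* ℝ⟦X⟧ := PowerSeries.map (MvPolynomial.eval (coords a))

/-- Series with real coefficients, as series with constant polynomial coefficients. -/
def cst : ℝ⟦X⟧ →+* (PotPoly N)⟦X⟧ := PowerSeries.map MvPolynomial.C

@[simp] theorem ev_cst (a : PotSpace N) (f : ℝ⟦X⟧) : ev a (cst f) = f := by
  ext n; simp [ev, cst]

@[simp] theorem ev_X (a : PotSpace N) : ev a X = X := by simp [ev]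

@[simp] theorem cst_X : (cst X : (PotPoly N)⟦X⟧) = X := by simp [cst]

theorem coeff_ev (a : PotSpace N) (n : ℕ) (f : (PotPoly N)⟦X⟧) :
    coeff n (ev a f) = MvPolynomial.eval (coords a) (coeff n f) := by simp [ev]

/-- The generating series `1 + u_1 λ + … + u_N λ^N`. -/
def uSer : (PotPoly N)⟦X⟧ := PowerSeries.mk fun
  | 0 => 1
  | n + 1 => if h : n < N then MvPolynomial.X (.inl ⟨n, h⟩) else 0

/-- The generating series `v_1 λ + … + v_N λ^N`. -/
def vSer : (PotPoly N)⟦X⟧ := PowerSeries.mk fun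
  | 0 => 0
  | n + 1 => if h : n < N then MvPolynomial.X (.inr (.inl ⟨n, h⟩)) else 0

/-- The generating series `w_1 λ + … + w_N λ^N`. -/
def wSer : (PotPoly N)⟦X⟧ := PowerSeries.mk fun
  | 0 => 0
  | n + 1 => if h : n < N then MvPolynomial.X (.inr (.inr ⟨n, h⟩)) else 0

/-- The series `q` with `q u = 2 + λ v w`. The matrix with rows `(u, v)` and `(λ w, q)` has
determinant `2`. -/
def qSer : (PotPoly N)⟦X⟧ := (2 + X * vSer * wSer) * invOfUnit uSer 1

theorem qSer_mul_uSer : (qSer : (PotPoly N)⟦X⟧) * uSer = 2 + X * vSer * wSer := by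
  rw [qSer, mul_assoc, mul_comm _ uSer, mul_invOfUnit, mul_one]
  simp [uSer]

/-! ### Polynomial vector fields -/

/-- The value at `a` of the vector field with generating series `t`. -/
def fieldAt (t : PolyField N) (a : PotSpace N) : PotSpace N :=
  (fun i => coeff (i + 1) (ev a t.1), fun i => coeff (i + 1) (ev a t.2.1),
    fun i => coeff (i + 1) (ev a t.2.2))

/-- The derivation of the polynomial ring given by the vector field `t`. -/
def der (t : PolyField N) : Derivation ℝ (PotPoly N) (PotPoly N) :=
  MvPolynomial.mkDerivation ℝ (Sum.elim (fun i : Fin N => coeff (i + 1) t.1)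
    (Sum.elim (fun i : Fin N => coeff (i + 1) t.2.1) fun i : Fin N => coeff (i + 1) t.2.2))

/-- The coefficientwise action of the vector field `t` on series, so that `λ` is a constant. -/
def hat (t : PolyField N) (f : (PotPoly N)⟦X⟧) : (PotPoly N)⟦X⟧ :=
  PowerSeries.mk fun n => der t (coeff n f)

theorem hat_add (t : PolyField N) (f g) : hat t (f + g) = hat t f + hat t g := by
  ext1 n; simp [hat]

theorem hat_neg (t : PolyField N) (f) : hat t (-f) = -hat t f := by
  ext1 n; simp [hat]

theorem hat_mul (t : PolyField N) (f g) : hat t (f * g) = hat t f * g + f * hat t g := by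
  ext1 n
  simp only [hat, coeff_mk, coeff_mul, map_sum, Derivation.leibniz, map_add, smul_eq_mul,
    Finset.sum_add_distrib]
  rw [add_comm]
  congr 1
  exact Finset.sum_congr rfl fun _ _ => mul_comm _ _

@[simp] theorem hat_cst (t : PolyField N) (f : ℝ⟦X⟧) : hat t (cst f) = 0 := by
  ext1 n
  simp only [hat, cst, coeff_mk, coeff_map, map_zero]
  exact (der t).map_algebraMap _

theorem hat_X (t : PolyField N) : hat t X = 0 := by rw [← cst_X, hat_cst]

@[simp] theorem hat_zero (t : PolyField N) : hat t 0 = 0 := by simpa using hat_cst t 0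

theorem hat_two (t : PolyField N) : hat t 2 = 0 := by
  rw [← map_ofNat cst 2, hat_cst]

/-- The vector field `t` acts on `u` by its first component, up to the truncation at `λ^N`. -/
theorem dvd_hat_uSer_sub {t : PolyField N} (h : constantCoeff t.1 = 0) :
    X ^ (N + 1) ∣ hat t uSer - t.1 := by
  rw [X_pow_dvd_iff]
  rintro (_ | m) hm
  · simp [hat, uSer, h]
  · simp [hat, uSer, Nat.succ_lt_succ_iff.1 hm, der]

theorem dvd_hat_vSer_sub {t : PolyField N} (h : constantCoeff t.2.1 = 0) :
    X ^ (N + 1) ∣ hat t vSer - t.2.1 := by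
  rw [X_pow_dvd_iff]
  rintro (_ | m) hm
  · simp [hat, vSer, h]
  · simp [hat, vSer, Nat.succ_lt_succ_iff.1 hm, der]

theorem dvd_hat_wSer_sub {t : PolyField N} (h : constantCoeff t.2.2 = 0) :
    X ^ (N + 1) ∣ hat t wSer - t.2.2 := by
  rw [X_pow_dvd_iff]
  rintro (_ | m) hm
  · simp [hat, wSer, h]
  · simp [hat, wSer, Nat.succ_lt_succ_iff.1 hm, der]

/-- The action of `t` on `q` is found modulo `λ^{N+1}` by differentiating `q u = 2 + λ v w` and
dividing by the unit `u`. -/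
theorem dvd_hat_qSer_sub {t : PolyField N} (h₁ : constantCoeff t.1 = 0)
    (h₂ : constantCoeff t.2.1 = 0) (h₃ : constantCoeff t.2.2 = 0) {s : (PotPoly N)⟦X⟧}
    (hs : s * uSer + qSer * t.1 = X * (t.2.1 * wSer + vSer * t.2.2)) :
    X ^ (N + 1) ∣ hat t qSer - s := by
  obtain ⟨ru, hu⟩ := dvd_hat_uSer_sub h₁
  obtain ⟨rv, hv⟩ := dvd_hat_vSer_sub h₂
  obtain ⟨rw', hw⟩ := dvd_hat_wSer_sub h₃
  have hq := congrArg (hat t) (qSer_mul_uSer (N := N))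
  simp only [hat_mul, hat_add, hat_two, hat_X] at hq
  have hunit : uSer * invOfUnit uSer 1 = (1 : (PotPoly N)⟦X⟧) :=
    mul_invOfUnit _ _ (by simp [uSer])
  refine ⟨(X * (rv * wSer + vSer * rw') - qSer * ru) * invOfUnit uSer 1, ?_⟩
  linear_combination (-(hat t qSer - s)) * hunit + invOfUnit uSer 1 * (hq - hs
    + X * wSer * hv + X * vSer * hw - qSer * hu)

theorem contDiff_eval (p : PotPoly N) :
    ContDiff ℝ ∞ (fun a : PotSpace N => MvPolynomial.eval (coords a) p) := by
  induction p using MvPolynomial.induction_on with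
  | C r => simpa using contDiff_const
  | add p q hp hq => simpa using hp.add hq
  | mul_X p i hp =>
    simp only [map_mul, MvPolynomial.eval_X]
    refine hp.mul ?_
    rcases i with i | i | i <;> simp only [coords, Sum.elim_inl, Sum.elim_inr] <;> fun_prop

theorem fderiv_eval (p : PotPoly N) (t : PolyField N) (a : PotSpace N) :
    fderiv ℝ (fun a : PotSpace N => MvPolynomial.eval (coords a) p) a (fieldAt t a)
      = MvPolynomial.eval (coords a) (der t p) := by
  have hd : ∀ p : PotPoly N, DifferentiableAt ℝ
      (fun a : PotSpace N => MvPolynomial.eval (coords a) p) a :=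
    fun p => (contDiff_eval p).differentiable (by simp) a
  induction p using MvPolynomial.induction_on with
  | C r =>
    have : der t (MvPolynomial.C r) = 0 := (der t).map_algebraMap _
    simp [this]
  | add p q hp hq =>
    simp only [map_add]
    rw [fderiv_fun_add (hd p) (hd q), ← hp, ← hq]
    rfl
  | mul_X p i hp =>
    have hX : fderiv ℝ (fun a : PotSpace N => coords a i) a (fieldAt t a)
        = MvPolynomial.eval (coords a) (der t (MvPolynomial.X i)) := by
      have hL : ∀ L : PotSpace N →L[ℝ] ℝ, (∀ b, coords b i = L b) →
          fderiv ℝ (fun b : PotSpace N => coords b i) a (fieldAt t a)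
            = coords (fieldAt t a) i := by
        intro L hL
        have : (fun b : PotSpace N => coords b i) = L := funext hL
        rw [this, L.fderiv, hL]
      rcases i with i | i | i
      · rw [hL ((ContinuousLinearMap.proj i).comp (ContinuousLinearMap.fst ℝ _ _))
          fun _ => rfl]
        simp [fieldAt, der, coeff_ev, coords]
      · rw [hL ((ContinuousLinearMap.proj i).comp
          ((ContinuousLinearMap.fst ℝ _ _).comp (ContinuousLinearMap.snd ℝ _ _))) fun _ => rfl]
        simp [fieldAt, der, coeff_ev, coords]
      · rw [hL ((ContinuousLinearMap.proj i).comp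
          ((ContinuousLinearMap.snd ℝ _ _).comp (ContinuousLinearMap.snd ℝ _ _))) fun _ => rfl]
        simp [fieldAt, der, coeff_ev, coords]
    have hXd : DifferentiableAt ℝ (fun a : PotSpace N => coords a i) a := by
      simpa using hd (MvPolynomial.X i)
    simp only [map_mul, MvPolynomial.eval_X]
    rw [fderiv_fun_mul (hd p) hXd]
    simp [hp, hX]

theorem contDiff_fieldAt (t : PolyField N) : ContDiff ℝ ∞ (fieldAt t) := by
  refine ContDiff.prodMk (contDiff_pi.2 fun i => ?_)
    (ContDiff.prodMk (contDiff_pi.2 fun i => ?_) (contDiff_pi.2 fun i => ?_)) <;>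
    simpa only [coeff_ev] using contDiff_eval _

theorem fderiv_fieldAt (s t : PolyField N) (a : PotSpace N) :
    fderiv ℝ (fieldAt s) a (fieldAt t a)
      = fieldAt (hat t s.1, hat t s.2.1, hat t s.2.2) a := by
  have h : ∀ (f : (PotPoly N)⟦X⟧), HasFDerivAt
      (fun b (i : Fin N) => coeff (i + 1) (ev b f))
      (ContinuousLinearMap.pi fun i : Fin N => fderiv ℝ (fun b : PotSpace N =>
        MvPolynomial.eval (coords b) (coeff (i + 1) f)) a) a := fun f => by
    refine hasFDerivAt_pi.2 fun i => ?_
    simp only [coeff_ev]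
    exact ((contDiff_eval _).differentiable (by simp) a).hasFDerivAt
  have hs : HasFDerivAt (fieldAt s) _ a := (h s.1).prodMk ((h s.2.1).prodMk (h s.2.2))
  rw [hs.fderiv]
  refine Prod.ext ?_ (Prod.ext ?_ ?_) <;> ext i <;>
    exact (fderiv_eval _ t a).trans (by simp [fieldAt, coeff_ev, hat])

/-! ### Tangent fields -/

/-- The Lie bracket of polynomial vector fields. -/
def bracket (t s : PolyField N) : PolyField N :=
  (hat t s.1 - hat s t.1, hat t s.2.1 - hat s t.2.1, hat t s.2.2 - hat s t.2.2)

/-- The vector field `t` is tangent to the hypersurface `F = 0` in `U`. -/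
def Tangent (U : Set (PotSpace N)) (F : PotSpace N → ℝ) (t : PolyField N) : Prop :=
  ∀ a ∈ U, F a = 0 → fderiv ℝ F a (fieldAt t a) = 0

theorem fieldAt_sub (t s : PolyField N) (a : PotSpace N) :
    fieldAt (t - s) a = fieldAt t a - fieldAt s a := by
  refine Prod.ext ?_ (Prod.ext ?_ ?_) <;> ext i <;> simp [fieldAt]

theorem fieldAt_neg (t : PolyField N) (a : PotSpace N) : fieldAt (-t) a = -fieldAt t a := by
  refine Prod.ext ?_ (Prod.ext ?_ ?_) <;> ext i <;> simp [fieldAt]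

theorem fieldAt_congr {t s : PolyField N} (h₁ : X ^ (N + 1) ∣ t.1 - s.1)
    (h₂ : X ^ (N + 1) ∣ t.2.1 - s.2.1) (h₃ : X ^ (N + 1) ∣ t.2.2 - s.2.2) (a : PotSpace N) :
    fieldAt t a = fieldAt s a := by
  rw [← sub_eq_zero, ← fieldAt_sub]
  rw [X_pow_dvd_iff] at h₁ h₂ h₃
  refine Prod.ext ?_ (Prod.ext ?_ ?_) <;> ext i
  · simp [fieldAt, coeff_ev, h₁ (i + 1) (by omega), -map_sub]
  · simp [fieldAt, coeff_ev, h₂ (i + 1) (by omega), -map_sub]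
  · simp [fieldAt, coeff_ev, h₃ (i + 1) (by omega), -map_sub]

theorem Tangent.bracket {U : Set (PotSpace N)} {F : PotSpace N → ℝ}
    (hF : IsFunctionalDependence U F) {t s : PolyField N} (ht : Tangent U F t)
    (hs : Tangent U F s) : Tangent U F (bracket t s) := by
  intro a ha h0
  have := fderiv_lie_eq_zero hF.isOpen hF.smooth hF.regular (contDiff_fieldAt t)
    (contDiff_fieldAt s) ht hs ha h0
  rw [fderiv_fieldAt, fderiv_fieldAt, ← fieldAt_sub] at this
  exact this

/-! ### Fields of the loop algebra -/

/-- The infinitesimal right action of `f · diag(-1, 1)` on the matrix with rows `(u, v)` and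
`(λ w, q)`. -/
def hField (f : ℝ⟦X⟧) : PolyField N := (-(cst f * uSer), cst f * vSer, -(cst f * wSer))

/-- The infinitesimal right action of `f` times the upper triangular matrix unit: it adds multiples
of the first column `(u, λ w)` to the second one, `(v, q)`. -/
def pField (f : ℝ⟦X⟧) : PolyField N := (0, cst f * uSer, 0)

/-- The infinitesimal right action of `λ f` times the lower triangular matrix unit: it adds
multiples of the second column `(v, q)` to the first one, `(u, λ w)`. The factor `λ` in the entry
`λ w` cancels in the last component. -/
def mField (f : ℝ⟦X⟧) : PolyField N := (X * cst f * vSer, 0, cst f * qSer)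

theorem fieldAt_pField_C_mul (r : ℝ) (f : ℝ⟦X⟧) (a : PotSpace N) :
    fieldAt (pField (C r * f)) a = r • fieldAt (pField f) a := by
  refine Prod.ext ?_ (Prod.ext ?_ ?_) <;> ext i <;>
    simp [fieldAt, pField, mul_assoc, coeff_C_mul]

theorem fieldAt_mField_C_mul (r : ℝ) (f : ℝ⟦X⟧) (a : PotSpace N) :
    fieldAt (mField (C r * f)) a = r • fieldAt (mField f) a := by
  refine Prod.ext ?_ (Prod.ext ?_ ?_) <;> ext i <;>
    simp [fieldAt, mField, mul_assoc, mul_left_comm X (C r), coeff_C_mul]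

theorem bracket_hField_pField (f g : ℝ⟦X⟧) (a : PotSpace N) :
    fieldAt (bracket (hField (X * f)) (pField (X * g))) a
      = (-2 : ℝ) • fieldAt (pField (X * f * (X * g))) a := by
  rw [← fieldAt_pField_C_mul, map_neg, map_ofNat]
  obtain ⟨r₁, h₁⟩ := dvd_hat_uSer_sub (t := hField (N := N) (X * f)) (by simp [hField])
  obtain ⟨s₁, k₁⟩ := dvd_hat_uSer_sub (t := pField (N := N) (X * g)) (by simp [pField])
  obtain ⟨s₂, k₂⟩ := dvd_hat_vSer_sub (t := pField (N := N) (X * g)) (by simp [pField])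
  obtain ⟨s₃, k₃⟩ := dvd_hat_wSer_sub (t := pField (N := N) (X * g)) (by simp [pField])
  apply fieldAt_congr
  · refine ⟨cst (X * f) * s₁, ?_⟩
    simp only [bracket, hField, pField, hat_neg, hat_mul, hat_cst, hat_zero] at *
    linear_combination cst (X * f) * k₁
  · refine ⟨cst (X * g) * r₁ - cst (X * f) * s₂, ?_⟩
    simp only [bracket, hField, pField, hat_neg, hat_mul, hat_cst, hat_zero, map_mul, map_neg,
      map_ofNat] at *
    linear_combination cst X * cst g * h₁ - cst X * cst f * k₂
  · refine ⟨cst (X * f) * s₃, ?_⟩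
    simp only [bracket, hField, pField, hat_neg, hat_mul, hat_cst, hat_zero] at *
    linear_combination cst (X * f) * k₃

theorem bracket_hField_mField (f g : ℝ⟦X⟧) (a : PotSpace N) :
    fieldAt (bracket (hField (X * f)) (mField (X * g))) a
      = (2 : ℝ) • fieldAt (mField (X * f * (X * g))) a := by
  rw [← fieldAt_mField_C_mul, map_ofNat]
  obtain ⟨r₂, h₂⟩ := dvd_hat_vSer_sub (t := hField (N := N) (X * f)) (by simp [hField])
  obtain ⟨r₃, h₃⟩ := dvd_hat_qSer_sub (t := hField (N := N) (X * f)) (s := cst (X * f) * qSer)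
    (by simp [hField]) (by simp [hField]) (by simp [hField]) (by simp only [hField]; ring)
  obtain ⟨s₁, k₁⟩ := dvd_hat_uSer_sub (t := mField (N := N) (X * g)) (by simp [mField])
  obtain ⟨s₂, k₂⟩ := dvd_hat_vSer_sub (t := mField (N := N) (X * g)) (by simp [mField])
  obtain ⟨s₃, k₃⟩ := dvd_hat_wSer_sub (t := mField (N := N) (X * g)) (by simp [mField])
  apply fieldAt_congr
  · refine ⟨X * cst (X * g) * r₂ + cst (X * f) * s₁, ?_⟩
    simp only [bracket, hField, mField, hat_neg, hat_mul, hat_cst, hat_zero, hat_X, map_mul,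
      map_ofNat] at *
    linear_combination X * cst X * cst g * h₂ + cst X * cst f * k₁
  · refine ⟨-cst (X * f) * s₂, ?_⟩
    simp only [bracket, hField, mField, hat_neg, hat_mul, hat_cst, hat_zero] at *
    linear_combination -cst (X * f) * k₂
  · refine ⟨cst (X * g) * r₃ + cst (X * f) * s₃, ?_⟩
    simp only [bracket, hField, mField, hat_neg, hat_mul, hat_cst, hat_zero, map_mul,
      map_ofNat] at *
    linear_combination cst X * cst g * h₃ + cst X * cst f * k₃

theorem bracket_pField_mField (f g : ℝ⟦X⟧) (a : PotSpace N) :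
    fieldAt (bracket (pField (X * f)) (mField (X * g))) a
      = -fieldAt (hField (X * (X * f) * (X * g))) a := by
  rw [← fieldAt_neg]
  obtain ⟨r₂, h₂⟩ := dvd_hat_vSer_sub (t := pField (N := N) (X * f)) (by simp [pField])
  obtain ⟨r₃, h₃⟩ := dvd_hat_qSer_sub (t := pField (N := N) (X * f))
    (s := X * cst (X * f) * wSer)
    (by simp [pField]) (by simp [pField]) (by simp [pField]) (by simp only [pField]; ring)
  obtain ⟨s₁, k₁⟩ := dvd_hat_uSer_sub (t := mField (N := N) (X * g)) (by simp [mField])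
  apply fieldAt_congr
  · refine ⟨X * cst (X * g) * r₂, ?_⟩
    simp only [bracket, hField, pField, mField, hat_mul, hat_cst, hat_zero, hat_X, map_mul, cst_X,
      Prod.fst_neg] at *
    linear_combination X * X * cst g * h₂
  · refine ⟨-cst (X * f) * s₁, ?_⟩
    simp only [bracket, hField, pField, mField, hat_mul, hat_cst, hat_zero, hat_X, map_mul, cst_X,
      Prod.fst_neg, Prod.snd_neg] at *
    linear_combination -X * cst f * k₁
  · refine ⟨cst (X * g) * r₃, ?_⟩
    simp only [bracket, hField, pField, mField, hat_mul, hat_cst, hat_zero, hat_X, map_mul, cst_X,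
      Prod.snd_neg] at *
    linear_combination X * cst g * h₃

/-! ### The total derivatives over `x = y = 0` -/

/-- The point of the covering over `x = y = 0` with the given values of `z`, `z_x`, `z_y` and of the
first `N` potentials of each kind, all other coordinates being zero. -/
def jetPoint (a : PotSpace N) (z zx zy : ℝ) : Point
  | .x => 0
  | .y => 0
  | .z 0 => z
  | .z 1 => zx
  | .z (_ + 2) => 0
  | .zy 0 => zy
  | .zy (_ + 1) => 0
  | .u n => if h : n < N then a.1 ⟨n, h⟩ else 0
  | .v n => if h : n < N then a.2.1 ⟨n, h⟩ else 0
  | .w n => if h : n < N then a.2.2 ⟨n, h⟩ else 0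

theorem potentials_jetPoint (a : PotSpace N) (z zx zy : ℝ) :
    potentials N (jetPoint a z zx zy) = a := by
  simp [potentials, jetPoint]

theorem uPot_jetPoint (a : PotSpace N) (z zx zy : ℝ) (n : ℕ) :
    uPot (jetPoint a z zx zy) n = coeff n (ev a uSer) := by
  rcases n with _ | n
  · simp [uPot, coeff_ev, uSer]
  · by_cases h : n < N <;> simp [uPot, coeff_ev, uSer, jetPoint, h, coords]

theorem vPot_jetPoint (a : PotSpace N) (z zx zy : ℝ) (n : ℕ) :
    vPot (jetPoint a z zx zy) n = coeff n (ev a vSer) := by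
  rcases n with _ | n
  · simp [vPot, coeff_ev, vSer]
  · by_cases h : n < N <;> simp [vPot, coeff_ev, vSer, jetPoint, h, coords]

theorem wPot_jetPoint (a : PotSpace N) (z zx zy : ℝ) (n : ℕ) :
    wPot (jetPoint a z zx zy) n = coeff n (ev a wSer) := by
  rcases n with _ | n
  · simp [wPot, coeff_ev, wSer]
  · by_cases h : n < N <;> simp [wPot, coeff_ev, wSer, jetPoint, h, coords]

/-- The recurrence for `ū_n` at `x = y = 0`, as the equation `ū (2 - λ) u = 2 + λ v w` of series. -/
theorem mk_uBar_mul (a : PotSpace N) (z zx zy : ℝ) :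
    PowerSeries.mk (uBar (jetPoint a z zx zy)) * ((2 - X) * ev a uSer)
      = 2 + X * ev a vSer * ev a wSer := by
  set p := jetPoint a z zx zy with hp
  have hu : ev a uSer = PowerSeries.mk (uPot p) := by ext n; simp [hp, uPot_jetPoint]
  have hv : ev a vSer = PowerSeries.mk (vPot p) := by ext n; simp [hp, vPot_jetPoint]
  have hw : ev a wSer = PowerSeries.mk (wPot p) := by ext n; simp [hp, wPot_jetPoint]
  have hx : p .x = 0 := rfl
  have hy : p .y = 0 := rfl
  rw [hu, hv, hw]
  have h2 : ∀ (n : ℕ) (f : ℝ⟦X⟧), coeff n (2 * f) = 2 * coeff n f := by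
    intro n f
    rw [two_mul, map_add, two_mul]
  have conv : ∀ (f g : ℕ → ℝ) (k : ℕ), coeff k (PowerSeries.mk f * PowerSeries.mk g)
      = ∑ i : Fin (k + 1), f i * g (k - i) := by
    intro f g k
    rw [coeff_mul, Finset.Nat.sum_antidiagonal_eq_sum_range_succ_mk, Finset.sum_range]
    simp
  ext n
  rw [show PowerSeries.mk (uBar p) * ((2 - X) * PowerSeries.mk (uPot p))
    = 2 * (PowerSeries.mk (uPot p) * PowerSeries.mk (uBar p))
      - X * (PowerSeries.mk (uPot p) * PowerSeries.mk (uBar p)) by ring, mul_assoc, map_sub,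
    map_add, h2]
  rcases n with _ | k
  · have h20 : constantCoeff (2 : ℝ⟦X⟧) = 2 := map_ofNat _ 2
    simp [uPot, uBar, h20]
  · have h20 : coeff (k + 1) (2 : ℝ⟦X⟧) = 0 := by
      have := h2 (k + 1) 1
      simpa [coeff_one] using this
    rw [coeff_succ_X_mul, coeff_succ_X_mul, h20, conv, conv, conv, Fin.sum_univ_succ]
    have hb := uBar.eq_def p (k + 1)
    have hu0 : uPot p 0 = 1 := rfl
    have hus : ∀ n, uPot p (n + 1) = p (.u n) := fun _ => rfl
    simp only [hx, hy, Fin.val_zero, Fin.val_succ, Nat.add_sub_add_right, hu0, hus, Nat.sub_zero,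
      zero_mul, sub_zero] at hb ⊢
    linear_combination 2 * hb

theorem mk_uBar (a : PotSpace N) (z zx zy : ℝ) :
    PowerSeries.mk (uBar (jetPoint a z zx zy)) * (2 - X) = ev a qSer := by
  have h := mk_uBar_mul a z zx zy
  have hq := congrArg (ev a) (qSer_mul_uSer (N := N))
  simp only [map_mul, map_add, ev_X, map_ofNat] at hq
  have hu : ev a (uSer : (PotPoly N)⟦X⟧) ≠ 0 := by
    intro h0
    have := congrArg (coeff 0) h0
    rw [coeff_ev] at this
    simp [uSer] at this
  apply mul_right_cancel₀ hu
  rw [mul_assoc, h, hq]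

/-- Over `x = y = 0` the values of `ū_n` do not depend on the jet coordinates. -/
theorem uBar_jetPoint_eq (a : PotSpace N) (z zx zy : ℝ) (n : ℕ) :
    uBar (jetPoint a z zx zy) n = uBar (jetPoint a 1 0 0) n := by
  have h : PowerSeries.mk (uBar (jetPoint a z zx zy))
      = PowerSeries.mk (uBar (jetPoint a 1 0 0)) := by
    have h2 : (2 - X : ℝ⟦X⟧) ≠ 0 := by
      intro h0
      have := congrArg constantCoeff h0
      have h20 : constantCoeff (2 : ℝ⟦X⟧) = 2 := map_ofNat _ 2
      simp [h20] at this
    apply mul_right_cancel₀ h2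
    rw [mk_uBar, mk_uBar]
  simpa using congrArg (coeff n) h

/-- The geometric series `1 / (1 - λ)`, which generates the partial sums `psum`. -/
def geom : ℝ⟦X⟧ := PowerSeries.mk 1

theorem geom_eq : geom = 1 + X * geom := by
  have : geom * (1 - X) = 1 := mk_one_mul_one_sub_eq_one ℝ
  linear_combination this

theorem coeff_X_mul_X_mul_geom_mul (f : ℝ⟦X⟧) (m : ℕ) :
    coeff (m + 1) (X * (X * geom) * f) = psum (fun i => coeff i f) m := by
  rw [mul_assoc, mul_assoc, coeff_succ_X_mul]
  induction m with
  | zero => simp [psum]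
  | succ m ih =>
    rw [psum, Finset.sum_range_succ, ← psum, ← ih, coeff_succ_X_mul, ← map_add]
    congr 1
    linear_combination f * geom_eq

/-- The combination of `ū_n` in the `w`-rates becomes a multiple of `q`: `2 + λ / (1 - λ)` is
`(2 - λ) / (1 - λ)`, and `(2 - λ) ū = q`. -/
theorem psum_uBar (a : PotSpace N) (z zx zy : ℝ) (m : ℕ) :
    2 * uBar (jetPoint a z zx zy) m + psum (uBar (jetPoint a z zx zy)) m
      = coeff (m + 1) (X * geom * ev a qSer) := by
  have h1 := coeff_X_mul_X_mul_geom_mul (PowerSeries.mk (uBar (jetPoint a z zx zy))) m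
  simp only [coeff_mk] at h1
  have h2 : uBar (jetPoint a z zx zy) m
      = coeff (m + 1) (X * PowerSeries.mk (uBar (jetPoint a z zx zy))) := by
    rw [coeff_succ_X_mul, coeff_mk]
  rw [← h1, h2, two_mul, ← map_add, ← map_add, ← mk_uBar a z zx zy]
  congr 1
  linear_combination X * PowerSeries.mk (uBar (jetPoint a z zx zy)) * (-2) * geom_eq

/-- `D_x` over `x = y = 0`, decomposed according to its dependence on `z`, `z_x`, `z_y`. -/
theorem potentials_xRate (a : PotSpace N) (z zx zy : ℝ) (hz : z ≠ 0) :
    potentials N (xRate (jetPoint a z zx zy))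
      = (zy / 4) • fieldAt (hField X) a
        + ((zy + zx / z) / 8) • fieldAt (hField (X * (X * geom))) a
        - (z / 4) • fieldAt (mField (X * geom)) a
        - (1 / 4 : ℝ) • fieldAt (pField (X * (X * geom))) a := by
  have hS := fun (f : (PotPoly N)⟦X⟧) (m : ℕ) => coeff_X_mul_X_mul_geom_mul (ev a f) m
  have hL : ∀ (f : (PotPoly N)⟦X⟧) (m : ℕ), coeff (m + 1) (X * ev a f) = coeff m (ev a f) :=
    fun f m => coeff_succ_X_mul m _
  have eu : uPot (jetPoint a z zx zy) = fun n => coeff n (ev a uSer) :=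
    funext (uPot_jetPoint a z zx zy)
  have evv : vPot (jetPoint a z zx zy) = fun n => coeff n (ev a vSer) :=
    funext (vPot_jetPoint a z zx zy)
  have ew : wPot (jetPoint a z zx zy) = fun n => coeff n (ev a wSer) :=
    funext (wPot_jetPoint a z zx zy)
  refine Prod.ext ?_ (Prod.ext ?_ ?_) <;> ext i
  · simp only [potentials, xRate, uX, fieldAt, hField, mField, pField, map_neg, map_mul, ev_cst,
      ev_X, Prod.fst_add, Prod.fst_sub, Prod.smul_fst, Pi.add_apply, Pi.sub_apply, Pi.smul_apply,
      smul_eq_mul, map_zero, hS, hL, eu, evv, K₁, L₁]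
    simp only [jetPoint]
    field_simp
    ring
  · simp only [potentials, xRate, vX, fieldAt, hField, mField, pField, map_neg, map_mul, ev_cst,
      ev_X, Prod.fst_add, Prod.fst_sub, Prod.smul_fst, Prod.snd_add, Prod.snd_sub, Prod.smul_snd,
      Pi.add_apply, Pi.sub_apply, Pi.smul_apply,
      smul_eq_mul, map_zero, hS, hL, eu, evv, K₁, L₁, K₂, L₂]
    simp only [jetPoint]
    field_simp
    ring
  · have hq := psum_uBar a z zx zy i
    simp only [potentials, xRate, wX, fieldAt, hField, mField, pField, map_neg, map_mul, ev_cst,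
      ev_X, Prod.snd_add, Prod.snd_sub, Prod.smul_snd,
      Pi.add_apply, Pi.sub_apply, Pi.smul_apply,
      smul_eq_mul, map_zero, hS, hL, ew, dK₁, dL₁, dK₂, dL₂, ← hq]
    simp only [show jetPoint a z zx zy .y = 0 from rfl,
      show jetPoint a z zx zy (.z 0) = z from rfl, show jetPoint a z zx zy (.z 1) = zx from rfl,
      show jetPoint a z zx zy (.zy 0) = zy from rfl]
    field_simp
    ring

/-- Over `x = y = 0` and for `z_x = z_y = 0`, the direction `D_y` depends on `z` only through a
multiple of `1/z`, which the difference between `z = 2` and `z = 1` isolates. -/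
theorem potentials_yRate_sub (a : PotSpace N) :
    potentials N (yRate (jetPoint a 2 0 0)) - potentials N (yRate (jetPoint a 1 0 0))
      = (1 / 4 : ℝ) • fieldAt (pField X) a
        + (1 / 8 : ℝ) • fieldAt (pField (X * (X * geom))) a := by
  have hS := fun (f : (PotPoly N)⟦X⟧) (m : ℕ) => coeff_X_mul_X_mul_geom_mul (ev a f) m
  have hL : ∀ (f : (PotPoly N)⟦X⟧) (m : ℕ), coeff (m + 1) (X * ev a f) = coeff m (ev a f) :=
    fun f m => coeff_succ_X_mul m _
  have eu := fun z zx zy => (funext (uPot_jetPoint a z zx zy) : uPot (jetPoint a z zx zy) = _)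
  have evv := fun z zx zy => (funext (vPot_jetPoint a z zx zy) : vPot (jetPoint a z zx zy) = _)
  have ew := fun z zx zy => (funext (wPot_jetPoint a z zx zy) : wPot (jetPoint a z zx zy) = _)
  have eb : uBar (jetPoint a 2 0 0) = uBar (jetPoint a 1 0 0) :=
    funext (uBar_jetPoint_eq a 2 0 0)
  refine Prod.ext ?_ (Prod.ext ?_ ?_) <;> ext i
  · simp [potentials, yRate, uY, fieldAt, pField, eu, evv, K₁, L₁, jetPoint]
  · simp only [potentials, yRate, vY, fieldAt, pField, map_mul, ev_cst, Prod.fst_add, Prod.fst_sub,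
      Prod.smul_fst, Prod.snd_add, Prod.snd_sub, Prod.smul_snd, Pi.add_apply, Pi.sub_apply,
      Pi.smul_apply, smul_eq_mul, hS, hL, eu, evv, K₁, L₁, K₂, L₂]
    simp only [jetPoint]
    ring
  · simp only [potentials, yRate, wY, fieldAt, pField, map_zero, Prod.snd_add, Prod.snd_sub,
      Prod.smul_snd, Pi.add_apply, Pi.sub_apply,
      Pi.smul_apply, smul_eq_mul, ew, eb, dK₁, dL₁, dK₂, dL₂]
    simp only [show ∀ z, jetPoint a z 0 0 .y = 0 from fun _ => rfl,
      show ∀ z, jetPoint a z 0 0 (.z 0) = z from fun _ => rfl,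
      show ∀ z, jetPoint a z 0 0 (.z 1) = 0 from fun _ => rfl,
      show ∀ z, jetPoint a z 0 0 (.zy 0) = 0 from fun _ => rfl]
    ring

/-- The fields into which `D_x` and `D_y` decompose are tangent to a functional dependence, because
`z`, `z_x`, `z_y` vary freely over each point of the space of potentials. -/
theorem tangent_generators {U : Set (PotSpace N)} {F : PotSpace N → ℝ}
    (hF : IsFunctionalDependence U F) :
    Tangent U F (hField X) ∧ Tangent U F (hField (X * (X * geom))) ∧ Tangent U F (pField X) ∧
      Tangent U F (mField (X * geom)) := by
  have key : ∀ a ∈ U, F a = 0 → fderiv ℝ F a (fieldAt (hField X) a) = 0 ∧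
      fderiv ℝ F a (fieldAt (hField (X * (X * geom))) a) = 0 ∧
      fderiv ℝ F a (fieldAt (pField X) a) = 0 ∧
      fderiv ℝ F a (fieldAt (mField (X * geom)) a) = 0 := by
    intro a ha h0
    have hd : DifferentiableAt ℝ F a :=
      (hF.smooth.contDiffAt (hF.isOpen.mem_nhds ha)).differentiableAt (by simp)
    have hXY : ∀ z zx zy : ℝ, 0 < z →
        fderiv ℝ F a (potentials N (xRate (jetPoint a z zx zy))) = 0 ∧
        fderiv ℝ F a (potentials N (yRate (jetPoint a z zx zy))) = 0 := by
      intro z zx zy hz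
      have hp := potentials_jetPoint a z zx zy
      have hc := hF.compatible (jetPoint a z zx zy) hz (by rwa [hp]) (by rwa [hp])
      unfold totalDx totalDy at hc
      rw [totalD_eq_fderiv (by rwa [hp]), totalD_eq_fderiv (by rwa [hp]), hp] at hc
      exact hc
    -- Enough values of `(z, z_x, z_y)` to separate the coefficients of `D_x` and `D_y`.
    have e1 := (hXY 1 0 0 one_pos).1
    have e2 := (hXY 2 0 0 two_pos).1
    have e3 := (hXY 1 1 0 one_pos).1
    have e4 := (hXY 1 0 1 one_pos).1
    have e5 : fderiv ℝ F a (potentials N (yRate (jetPoint a 2 0 0))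
        - potentials N (yRate (jetPoint a 1 0 0))) = 0 := by
      rw [map_sub, (hXY 2 0 0 two_pos).2, (hXY 1 0 0 one_pos).2, sub_zero]
    rw [potentials_xRate _ _ _ _ (by norm_num)] at e1 e2 e3 e4
    rw [potentials_yRate_sub] at e5
    simp only [map_add, map_sub, map_smul, smul_eq_mul] at e1 e2 e3 e4 e5
    refine ⟨?_, ?_, ?_, ?_⟩ <;> linarith
  exact ⟨fun a ha h0 => (key a ha h0).1, fun a ha h0 => (key a ha h0).2.1,
    fun a ha h0 => (key a ha h0).2.2.1, fun a ha h0 => (key a ha h0).2.2.2⟩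

/-! ### Spanning the tangent space -/

theorem coeff_X_pow_succ_mul_ev (a : PotSpace N) (f : (PotPoly N)⟦X⟧) (k i : ℕ) :
    coeff (i + 1) (X ^ (k + 1) * ev a f) = if k ≤ i then coeff (i - k) (ev a f) else 0 := by
  rw [coeff_X_pow_mul']
  simp

/-- The brackets of the generators produce all the positive powers of `λ`: bracketing with
`hField λ` multiplies the series of `pField` and `mField` by `λ`, and the brackets of `pField λ`
with `mField` give `hField`. -/
theorem tangent_monomials {U : Set (PotSpace N)} {F : PotSpace N → ℝ}
    (hF : IsFunctionalDependence U F) (k : ℕ) :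
    Tangent U F (hField (X ^ (k + 1))) ∧ Tangent U F (pField (X ^ (k + 1))) ∧
      Tangent U F (mField (X ^ (k + 1))) := by
  obtain ⟨hH, hHg, hP, hMg⟩ := tangent_generators hF
  -- The bracket formulas expect series of the form `X * f`.
  have hH1 : Tangent U F (hField (X * 1)) := by rwa [mul_one]
  have hP1 : Tangent U F (pField (X * 1)) := by rwa [mul_one]
  have hP' : ∀ k : ℕ, Tangent U F (pField (X ^ (k + 1))) := by
    intro k
    induction k with
    | zero => simpa using hP
    | succ k ih =>
      rw [pow_succ'] at ih
      intro a ha h0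
      have h := hH1.bracket hF ih a ha h0
      rw [bracket_hField_pField, map_smul, smul_eq_mul, mul_eq_zero] at h
      convert h.resolve_left (by norm_num) using 4
      ring
  have hM' : ∀ k : ℕ, Tangent U F (mField (X ^ (k + 1))) := by
    intro k
    induction k with
    | zero =>
      intro a ha h0
      -- `λ = λ / (1 - λ) - λ² / (1 - λ)`
      have h1 := hH1.bracket hF hMg a ha h0
      have h2 := hMg a ha h0
      rw [bracket_hField_mField, map_smul, smul_eq_mul, mul_eq_zero] at h1
      have h3 := h1.resolve_left (by norm_num)
      have h4 : fieldAt (mField (N := N) (X ^ (0 + 1))) a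
          = fieldAt (mField (X * geom)) a - fieldAt (mField (X * 1 * (X * geom))) a := by
        rw [← fieldAt_sub]
        congr 1
        have hg : (X ^ (0 + 1) : ℝ⟦X⟧) = X * geom - X * 1 * (X * geom) := by
          linear_combination -X * geom_eq
        rw [hg]
        refine Prod.ext ?_ (Prod.ext ?_ ?_) <;> simp [mField, mul_sub, sub_mul]
      rw [h4, map_sub, h2, h3, sub_zero]
    | succ k ih =>
      rw [pow_succ'] at ih
      intro a ha h0
      have h := hH1.bracket hF ih a ha h0
      rw [bracket_hField_mField, map_smul, smul_eq_mul, mul_eq_zero] at h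
      convert h.resolve_left (by norm_num) using 4
      ring
  -- The bracket of `pField λ` with `mField (λ f)` is `-hField (λ³ f)`.
  have hPM : ∀ f : ℝ⟦X⟧, Tangent U F (mField (X * f)) → Tangent U F (hField (X ^ 3 * f)) := by
    intro f hf a ha h0
    have h := hP1.bracket hF hf a ha h0
    rw [bracket_pField_mField, map_neg, neg_eq_zero] at h
    convert h using 4
    ring
  refine ⟨?_, hP' k, hM' k⟩
  match k with
  | 0 => simpa using hH
  | 1 =>
    -- The brackets give powers from `λ³` on only, but `λ² = λ² / (1 - λ) - λ³ / (1 - λ)`.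
    intro a ha h0
    have h4 : fieldAt (hField (N := N) (X ^ (1 + 1))) a
        = fieldAt (hField (X * (X * geom))) a - fieldAt (hField (X ^ 3 * geom)) a := by
      rw [← fieldAt_sub]
      congr 1
      have hg : (X ^ (1 + 1) : ℝ⟦X⟧) = X * (X * geom) - X ^ 3 * geom := by
        linear_combination -X ^ 2 * geom_eq
      rw [hg]
      refine Prod.ext ?_ (Prod.ext ?_ ?_) <;> simp [hField, sub_mul] <;> abel
    rw [h4, map_sub, hHg a ha h0, hPM _ hMg a ha h0, sub_zero]
  | k + 2 =>
    have h := hPM (X ^ k) (by simpa [pow_succ'] using hM' k)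
    convert h using 2
    ring

/-- Part (a): the fields `hField λ^n`, `pField λ^n`, `mField λ^n` have lowest terms `-∂/∂u_n`,
`∂/∂v_n`, `2 ∂/∂w_n`, so they span the tangent space at every point, and all of them are tangent to
the hypersurface. -/
theorem not_isFunctionalDependence (U : Set (PotSpace N)) (F : PotSpace N → ℝ) :
    ¬ IsFunctionalDependence U F := by
  intro hF
  obtain ⟨a, ha, h0⟩ := hF.nonempty
  apply hF.regular a ha h0
  set ℓ := fderiv ℝ F a
  -- Descending induction on `k`, for vectors `e` whose components of index below `k` vanish.
  have key : ∀ d k : ℕ, k + d = N → ∀ e : PotSpace N,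
      (∀ i : Fin N, (i : ℕ) < k → e.1 i = 0 ∧ e.2.1 i = 0 ∧ e.2.2 i = 0) → ℓ e = 0 := by
    intro d
    induction d with
    | zero =>
      intro k hk e he
      have : e = 0 := by
        refine Prod.ext ?_ (Prod.ext ?_ ?_) <;> ext i
        · exact (he i (by omega)).1
        · exact (he i (by omega)).2.1
        · exact (he i (by omega)).2.2
      simp [this]
    | succ d ih =>
      intro k hk e he
      obtain ⟨hH, hP, hM⟩ := tangent_monomials hF k
      let k' : Fin N := ⟨k, by omega⟩
      have h := ih (k + 1) (by omega) (e + e.1 k' • fieldAt (hField (X ^ (k + 1))) a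
        - e.2.1 k' • fieldAt (pField (X ^ (k + 1))) a
        - (e.2.2 k' / 2) • fieldAt (mField (X ^ (k + 1))) a) ?_
      · simpa [ℓ, hH a ha h0, hP a ha h0, hM a ha h0] using h
      · have hu : coeff 0 (ev a (uSer : (PotPoly N)⟦X⟧)) = 1 := by rw [coeff_ev]; simp [uSer]
        have hv : coeff 0 (ev a (vSer : (PotPoly N)⟦X⟧)) = 0 := by rw [coeff_ev]; simp [vSer]
        have hw : coeff 0 (ev a (wSer : (PotPoly N)⟦X⟧)) = 0 := by rw [coeff_ev]; simp [wSer]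
        have hq : coeff 0 (ev a (qSer : (PotPoly N)⟦X⟧)) = 2 := by
          have h20 : constantCoeff (2 : (PotPoly N)⟦X⟧) = 2 := map_ofNat _ 2
          rw [coeff_ev]
          simp [qSer, h20]
        have hXv : ∀ i : ℕ, i ≤ k → coeff (i + 1) (X * X ^ (k + 1) * ev a vSer) = 0 := by
          intro i hi
          rw [← pow_succ', coeff_X_pow_mul', if_neg (by omega)]
        intro i hi
        have hik : (i : ℕ) ≤ k := by omega
        simp only [fieldAt, hField, pField, mField, map_neg, map_mul, ev_cst, ev_X, map_zero,
          coeff_X_pow_succ_mul_ev, Prod.fst_add, Prod.fst_sub, Prod.smul_fst, Prod.snd_add,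
          Prod.snd_sub, Prod.smul_snd, Pi.add_apply, Pi.sub_apply, Pi.smul_apply, smul_eq_mul,
          hXv i hik]
        rcases hik.lt_or_eq with h | h
        · obtain ⟨h1, h2, h3⟩ := he i h
          simp [h1, h2, h3, not_le.2 h]
        · obtain rfl : i = k' := Fin.ext h
          simp only [k', le_refl, if_true, Nat.sub_self, hu, hv, hw, hq]
          refine ⟨?_, ?_, ?_⟩ <;> ring
  exact ContinuousLinearMap.ext fun e => key N 0 (by omega) e (by simp)

/-- Part (b) follows from part (a): near a point `a` with `dF ≠ 0`, the equation `F = F a` would be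
a functional dependence, so `dF` vanishes on `U`. -/
theorem exists_const_of_isKilledByTotalDerivatives {U : Set (PotSpace N)} {F : PotSpace N → ℝ}
    (hU : IsOpen U) (hconn : IsConnected U) (hF : ContDiffOn ℝ ∞ F U)
    (hkill : IsKilledByTotalDerivatives U F) : ∃ c : ℝ, ∀ a ∈ U, F a = c := by
  have hdF : Set.EqOn (fderiv ℝ F) 0 U := by
    intro a ha
    by_contra hne
    have hcont : ContinuousOn (fderiv ℝ F) U := hF.continuousOn_fderiv_of_isOpen hU (by simp)
    have hfd : fderiv ℝ (fun b => F b - F a) = fderiv ℝ F := by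
      ext1 b
      rw [fderiv_sub_const]
    have hpd : ∀ c, pd c (fun q => F (potentials N q) - F a)
        = pd c (fun q => F (potentials N q)) := by
      intro c
      ext p
      simp [pd]
    refine not_isFunctionalDependence (U ∩ fderiv ℝ F ⁻¹' {0}ᶜ) (fun b => F b - F a)
      ⟨hcont.isOpen_inter_preimage hU isOpen_compl_singleton,
        (hF.mono Set.inter_subset_left).sub contDiffOn_const, ⟨a, ⟨ha, hne⟩, sub_self _⟩, ?_, ?_⟩
    · intro b hb _
      rw [hfd]
      exact hb.2
    · intro p hp hpU _
      unfold totalDx totalDy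
      simp only [hpd]
      exact hkill p hp hpU.1
  obtain ⟨c, hc⟩ := hU.exists_is_const_of_fderiv_eq_zero hconn.isPreconnected
    (hF.differentiableOn (by simp)) hdF
  exact ⟨c, hc⟩

end

end ConstantAstigmatism

theorem mainTheorem2 (N : ℕ) (U : Set (ConstantAstigmatism.PotSpace N))
    (F : ConstantAstigmatism.PotSpace N → ℝ) :
    ¬ ConstantAstigmatism.IsFunctionalDependence U F ∧
      (IsOpen U → IsConnected U → ContDiffOn ℝ ∞ F U →
        ConstantAstigmatism.IsKilledByTotalDerivatives U F → ∃ c : ℝ, ∀ a ∈ U, F a = c) := by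
  exact ⟨ConstantAstigmatism.not_isFunctionalDependence U F,
    ConstantAstigmatism.exists_const_of_isKilledByTotalDerivatives⟩
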